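/- Let $d\ge 4$ be an even integer and let $k\in\mathbb N$ be such that $p:=k-\frac d2\in\mathbb N_0$. Let $\mathbf x,\mathbf x'\in\mathbb R^d$ have Euclidean norms $r:=\|\mathbf x\|>0$, $r':=\|\mathbf x'\|>0$ with $r\neq r'$; put $r_>:=\max\{r,r'\}$, $r_<:=\min\{r,r'\}$, $\zeta:=\dfrac{r^2+r'^2}{2rr'}>1$, and let $\gamma\in[0,\pi]$ be the separation angle, $\cos\gamma=\dfrac{(\mathbf x,\mathbf x')}{rr'}$ (so in any Vilenkin polyspherical coordinate system $r,r'$ are the radial coordinates and $\gamma$ is the separation angle). Then the binomial kernel $\mathfrak j_k^d(\mathbf x,\mathbf x'):=\|\mathbf x-\mathbf x'\|^{2k-d}=\|\mathbf x-\mathbf x'\|^{2p}$ satisfies $$ \mathfrak j_k^d(\mathbf x,\mathbf x')=i(-1)^{p-\frac d2}\,\frac{2^{\frac{d-1}2}}{\sqrt\pi}\,p!\,\bigl(\tfrac d2-2\bigr)!\,(2rr')^p\left(\frac{r_>^2-r_<^2}{2rr'}\right)^{p+\frac{d-1}2}\sum_{n=0}^p\frac{(-1)^n\,(n+\frac d2-1)\,C_n^{\frac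 d2-1}(\cos\gamma)}{(p-n)!\,(n+p+d-2)!}\,Q_{n+\frac{d-3}2}^{p+\frac{d-1}2}(\zeta). $$ Here $C_n^\nu$ is the Gegenbauer polynomial, $$C_n^\nu(x)=\frac{(2\nu)_n}{n!}\,{}_2F_1\!\left(-n,\,n+2\nu;\,\nu+\tfrac12;\,\tfrac{1-x}2\right),$$ and $Q_\nu^\mu$ is the associated Legendre function of the second kind, which for $z>1$ is $$Q_\nu^\mu(z)=\frac{\sqrt\pi\,e^{i\pi\mu}\,\Gamma(\nu+\mu+1)\,(z^2-1)^{\mu/2}}{2^{\nu+1}\,\Gamma(\nu+\frac32)\,z^{\nu+\mu+1}}\;{}_2F_1\!\left(\tfrac{\nu+\mu+1}2,\,\tfrac{\nu+\mu+2}2;\,\nu+\tfrac32;\,\tfrac1{z^2}\right).$$ -/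

import Mathlib

noncomputable section

/-- The binomial kernel `𝔧_k^d(x, x') = ‖x - x'‖^(2k - d)` on `ℝ^d × ℝ^d`
(Euclidean norm, integer exponent). -/
def binomialKernel (d k : ℕ) (x x' : EuclideanSpace ℝ (Fin d)) : ℝ :=
  ‖x - x'‖ ^ (2 * (k : ℤ) - (d : ℤ))

/-- `ζ(r, r') = (r² + r'²) / (2 r r')`. -/
def zetaParam (r r' : ℝ) : ℝ := (r ^ 2 + r' ^ 2) / (2 * r * r')

/-- The Gegenbauer polynomial
`C_n^ν(x) = (2ν)_n / n! * ₂F₁(-n, n + 2ν; ν + 1/2; (1 - x)/2)`,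
for `ν ∈ (-1/2, ∞) \ {0}` and `x ∈ ℂ`; the hypergeometric series terminates. -/
def gegenbauerC (n : ℕ) (ν : ℝ) (x : ℂ) : ℂ :=
  (((ascPochhammer ℝ n).eval (2 * ν) / (n.factorial : ℝ) : ℝ) : ℂ) *
    ordinaryHypergeometric (-(n : ℂ)) ((n : ℂ) + 2 * (ν : ℂ)) ((ν : ℂ) + 1 / 2) ((1 - x) / 2)

/-- The associated Legendre function of the second kind `Q_ν^μ(z)` for `z ∉ (-∞, 1]`, `|z| > 1`
(where the hypergeometric series in `1/z²` converges; only arguments `z > 1` occur below).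
All powers are principal, and `(z² - 1)^(μ/2)` is read as `(z + 1)^(μ/2) * (z - 1)^(μ/2)`. -/
def legendreQ (ν μ z : ℂ) : ℂ :=
  ((Real.sqrt Real.pi : ℝ) : ℂ) * Complex.exp (Complex.I * (Real.pi : ℂ) * μ) *
      Complex.Gamma (ν + μ + 1) * ((z + 1) ^ (μ / 2) * (z - 1) ^ (μ / 2)) /
    ((2 : ℂ) ^ (ν + 1) * Complex.Gamma (ν + 3 / 2) * z ^ (ν + μ + 1)) *
    ordinaryHypergeometric ((ν + μ + 1) / 2) ((ν + μ + 2) / 2) (ν + 3 / 2) (1 / z ^ 2)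

end

/-!
By the law of cosines `‖x - x'‖² = 2 r r' (ζ - cos γ)`, so the kernel is `(2 r r')^p (ζ - cos γ)^p`,
and the claim is the Gegenbauer expansion of the polynomial `(ζ - t)^p` in `t`. The apparent
transcendence of the right-hand side disappears: with `N = p - n` and `c = n + d/2`, the
hypergeometric function in `Q_{n+(d-3)/2}^{p+(d-1)/2}(ζ)` is `₂F₁(c + (N-1)/2, c + N/2; c; 1/ζ²)`,
which Euler's transformation turns into `(1 - 1/ζ²)^{-(c+N-1/2)}` times the polynomial
`₂F₁(-N/2, (1-N)/2; c; 1/ζ²)`. All powers of `ζ² - 1` then cancel (`rpow_mul_legendreQ`), as do the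
phases (`I_mul_zpow_mul_exp`).

Only this terminating case of Euler's transformation is needed. It is proved in
`ordinaryHypergeometric_euler_terminating` by induction on `N`: the contiguous relation
`ordinaryHypergeometric_half_step`, which holds for arbitrary parameters, yields the same three-term
recurrence for both sides, and the initial cases are binomial series.

On the other side, `two_mul_pow_eq_weightSum_gegenbauerC` expands a monomial in Gegenbauer
polynomials, by induction on the degree through the three-term recurrence
`gegenbauerC_recurrence`. Inserting it into the binomial expansion of `(ζ - t)^p` and collecting
the terms that belong to `C_n` produces exactly the polynomials above
(`sub_pow_eq_sum_gegenbauerC`).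
-/

/-! ### Hypergeometric series and a terminating Euler transformation -/

open Polynomial in
theorem ascPochhammer_eval_succ_left (k : ℕ) (a : ℂ) :
    (ascPochhammer ℂ (k + 1)).eval a = a * (ascPochhammer ℂ k).eval (a + 1) := by
  simp [ascPochhammer_succ_left, eval_comp]

/-- The `k`-th term of the series `₂F₁(a, b; c; x)`. -/
noncomputable def hypTerm (a b c x : ℂ) (k : ℕ) : ℂ :=
  ((k.factorial : ℂ)⁻¹ * (ascPochhammer ℂ k).eval a * (ascPochhammer ℂ k).eval b *
    ((ascPochhammer ℂ k).eval c)⁻¹) * x ^ k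

theorem ordinaryHypergeometric_eq_tsum_hypTerm (a b c x : ℂ) :
    ordinaryHypergeometric a b c x = ∑' k, hypTerm a b c x k := by
  simp [ordinaryHypergeometric_eq_tsum, hypTerm]

theorem hypTerm_zero (a b c x : ℂ) : hypTerm a b c x 0 = 1 := by simp [hypTerm]

theorem hypTerm_eq_zero (n : ℕ) {k : ℕ} (h : n < k) (b c x : ℂ) : hypTerm (-n) b c x k = 0 := by
  have : (ascPochhammer ℂ k).eval (-(n : ℂ)) = 0 :=
    (ascPochhammer_eval_eq_zero_iff k _).2 ⟨n, h, by simp⟩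
  simp [hypTerm, this]

theorem summable_hypTerm_neg_nat (n : ℕ) (b c x : ℂ) : Summable (hypTerm (-n) b c x) :=
  summable_of_ne_finset_zero (s := Finset.range (n + 1)) fun k hk ↦
    hypTerm_eq_zero n (by rw [Finset.mem_range] at hk; omega) b c x

theorem ascPochhammer_eval_ne_zero {c : ℂ} (hc : ∀ k : ℕ, (k : ℂ) ≠ -c) (n : ℕ) :
    (ascPochhammer ℂ n).eval c ≠ 0 := fun h ↦ by
  obtain ⟨k, -, hk⟩ := (ascPochhammer_eval_eq_zero_iff n c).1 h
  exact hc k hk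

theorem summable_hypTerm (a b : ℂ) {c x : ℂ} (hc : ∀ k : ℕ, (k : ℂ) ≠ -c) (hx : ‖x‖ < 1) :
    Summable (hypTerm a b c x) := by
  have hr : 1 ≤ (ordinaryHypergeometricSeries ℂ a b c).radius := by
    by_cases ha : ∃ k : ℕ, (k : ℂ) = -a
    · obtain ⟨k, hk⟩ := ha
      obtain rfl : a = -(k : ℂ) := by rw [hk, neg_neg]
      simp [ordinaryHypergeometric_radius_top_of_neg_nat₁]
    by_cases hb : ∃ k : ℕ, (k : ℂ) = -b
    · obtain ⟨k, hk⟩ := hb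
      obtain rfl : b = -(k : ℂ) := by rw [hk, neg_neg]
      simp [ordinaryHypergeometric_radius_top_of_neg_nat₂]
    · push Not at ha hb
      exact (ordinaryHypergeometricSeries_radius_eq_one ℂ a b c fun k ↦ ⟨ha k, hb k, hc k⟩).ge
  have hmem : x ∈ Metric.eball (0 : ℂ) (ordinaryHypergeometricSeries ℂ a b c).radius := by
    refine Metric.eball_subset_eball hr ?_
    rw [← ENNReal.ofReal_one, Metric.eball_ofReal]
    simpa using hx
  refine ((ordinaryHypergeometricSeries ℂ a b c).summable hmem).congr fun k ↦ ?_
  rw [ordinaryHypergeometricSeries_apply_eq, smul_eq_mul, hypTerm]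

/-- Contiguous relation along the direction `a ↦ a + 1/2` for the functions
`₂F₁(a, a + 1/2; c; x)`. It holds for every `a`, in particular for the polynomial cases. -/
theorem ordinaryHypergeometric_half_step (a : ℂ) {c x : ℂ} (hc : ∀ k : ℕ, (k : ℂ) ≠ -c)
    (hx : ‖x‖ < 1) :
    (2 * a + 1) * (1 - x) * ordinaryHypergeometric (a + 1) (a + 3 / 2) c x
      - (4 * a + 3 - 2 * c) * ordinaryHypergeometric (a + 1 / 2) (a + 1) c x
      + (2 * a - 2 * c + 2) * ordinaryHypergeometric a (a + 1 / 2) c x = 0 := by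
  have s2 := summable_hypTerm (a + 1) (a + 3 / 2) hc hx
  have s1 := summable_hypTerm (a + 1 / 2) (a + 1) hc hx
  have s0 := summable_hypTerm a (a + 1 / 2) hc hx
  -- the relation, coefficient by coefficient; the constant terms are compared at the end
  have key : ∀ k, (2 * a + 1) * hypTerm (a + 1) (a + 3 / 2) c x (k + 1)
      - (2 * a + 1) * x * hypTerm (a + 1) (a + 3 / 2) c x k
      - (4 * a + 3 - 2 * c) * hypTerm (a + 1 / 2) (a + 1) c x (k + 1)
      + (2 * a - 2 * c + 2) * hypTerm a (a + 1 / 2) c x (k + 1) = 0 := by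
    intro k
    have hk : (k : ℂ) + 1 ≠ 0 := by exact_mod_cast k.succ_ne_zero
    have hP := ascPochhammer_eval_ne_zero hc k
    have hck : c + k ≠ 0 := fun h ↦ hc k (by linear_combination h)
    have hf : (k.factorial : ℂ) ≠ 0 := by exact_mod_cast k.factorial_ne_zero
    have e1 : a + 1 / 2 + 1 = a + 3 / 2 := by ring
    simp only [hypTerm, Nat.factorial_succ, ascPochhammer_eval_succ_left k a,
      ascPochhammer_eval_succ_left k (a + 1 / 2), e1, ascPochhammer_succ_eval k (a + 1),
      ascPochhammer_succ_eval k (a + 3 / 2), ascPochhammer_succ_eval k c]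
    push_cast
    field_simp
    ring
  have t2 := s2.tsum_eq_zero_add
  have hsum : (2 * a + 1) * (∑' k, hypTerm (a + 1) (a + 3 / 2) c x (k + 1))
      - (2 * a + 1) * x * (∑' k, hypTerm (a + 1) (a + 3 / 2) c x k)
      - (4 * a + 3 - 2 * c) * (∑' k, hypTerm (a + 1 / 2) (a + 1) c x (k + 1))
      + (2 * a - 2 * c + 2) * (∑' k, hypTerm a (a + 1 / 2) c x (k + 1)) = 0 := by
    have h2 := ((summable_nat_add_iff 1).2 s2).hasSum.mul_left (2 * a + 1)
    have h2' := s2.hasSum.mul_left ((2 * a + 1) * x)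
    have h1 := ((summable_nat_add_iff 1).2 s1).hasSum.mul_left (4 * a + 3 - 2 * c)
    have h0 := ((summable_nat_add_iff 1).2 s0).hasSum.mul_left (2 * a - 2 * c + 2)
    have := ((h2.sub h2').sub h1).add h0
    simp only [key] at this
    exact this.unique hasSum_zero
  have t1 := s1.tsum_eq_zero_add
  have t0 := s0.tsum_eq_zero_add
  rw [hypTerm_zero] at t0 t1 t2
  simp only [ordinaryHypergeometric_eq_tsum_hypTerm]
  linear_combination hsum + (2 * a + 1) * t2 - (4 * a + 3 - 2 * c) * t1 + (2 * a - 2 * c + 2) * t0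

/-- The binomial series as a hypergeometric function. -/
theorem ordinaryHypergeometric_self_right (a : ℂ) {c x : ℂ} (hc : ∀ k : ℕ, (k : ℂ) ≠ -c)
    (hx : ‖x‖ < 1) : ordinaryHypergeometric a c c x = (1 - x) ^ (-a) := by
  have h := Complex.one_add_cpow_hasFPowerSeriesOnBall_zero (a := -a)
  rw [binomialSeries_eq_ordinaryHypergeometricSeries hc, neg_neg] at h
  have hm : -x ∈ Metric.eball (0 : ℂ) 1 := by
    rw [← ENNReal.ofReal_one, Metric.eball_ofReal]
    simpa using hx
  have := (h.hasSum hm).tsum_eq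
  rw [zero_add, ← sub_eq_add_neg] at this
  rw [← this, ordinaryHypergeometric, FormalMultilinearSeries.sum]
  refine tsum_congr fun n ↦ ?_
  rw [FormalMultilinearSeries.compContinuousLinearMap_apply]
  congr 1
  ext i
  simp

/-- Euler's transformation of `₂F₁(c + (N - 1)/2, c + N/2; c; x)` into a polynomial in `x`. Both
sides satisfy the same three-term recurrence in `N`, which is
`ordinaryHypergeometric_half_step` at `a = c + (N - 1)/2` and at `a = -N/2 - 1` respectively. -/
theorem ordinaryHypergeometric_euler_terminating {c x : ℂ} (hc : ∀ k : ℕ, (k : ℂ) ≠ -c)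
    (hc2 : ∀ k : ℕ, 2 * c + k ≠ 0) (hx : ‖x‖ < 1) (N : ℕ) :
    ordinaryHypergeometric (c + (N - 1) / 2) (c + N / 2) c x * (1 - x) ^ (c + N - 1 / 2) =
      ordinaryHypergeometric (-N / 2 : ℂ) ((1 - N) / 2) c x := by
  have hx1 : 1 - x ≠ 0 := by
    rintro h
    rw [← sub_eq_zero.1 h] at hx
    simp at hx
  have hpow (N : ℕ) : (1 - x) ^ (c + N - 1 / 2) = (1 - x) ^ (c - 1 / 2) * (1 - x) ^ N := by
    rw [← Complex.cpow_natCast, ← Complex.cpow_add _ _ hx1]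
    ring_nf
  have hz (b : ℂ) : ordinaryHypergeometric 0 b c x = 1 := by
    rw [ordinaryHypergeometric_eq_tsum_hypTerm, tsum_eq_single 0, hypTerm_zero]
    intro k hk
    simpa using hypTerm_eq_zero 0 (Nat.pos_of_ne_zero hk) b c x
  induction N using Nat.twoStepInduction with
  | zero =>
    have h := ordinaryHypergeometric_self_right (c - 1 / 2) hc hx
    have e1 : c + (((0 : ℕ) : ℂ) - 1) / 2 = c - 1 / 2 := by push_cast; ring
    have e2 : c + ((0 : ℕ) : ℂ) / 2 = c := by simp
    have e3 : -((0 : ℕ) : ℂ) / 2 = 0 := by simp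
    have e4 : c + ((0 : ℕ) : ℂ) - 1 / 2 = c - 1 / 2 := by simp
    rw [e1, e2, e3, e4, h, hz, ← Complex.cpow_add _ _ hx1]
    simp
  | one =>
    have h := ordinaryHypergeometric_self_right (c + 1 / 2) hc hx
    have e1 : c + (((1 : ℕ) : ℂ) - 1) / 2 = c := by simp
    have e2 : c + ((1 : ℕ) : ℂ) / 2 = c + 1 / 2 := by simp
    have e3 : (1 - ((1 : ℕ) : ℂ)) / 2 = 0 := by simp
    have e4 : c + ((1 : ℕ) : ℂ) - 1 / 2 = c + 1 / 2 := by push_cast; ring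
    have hs (a b : ℂ) : ordinaryHypergeometric a b c x = ordinaryHypergeometric b a c x := by
      rw [ordinaryHypergeometric, ordinaryHypergeometric, ordinaryHypergeometricSeries_symm]
    rw [e1, e2, e3, e4, hs, h, hs, hz, ← Complex.cpow_add _ _ hx1]
    simp
  | more N ih0 ih1 =>
    have hH := ordinaryHypergeometric_half_step (c + ((N : ℂ) - 1) / 2) hc hx
    have hG := ordinaryHypergeometric_half_step (-((N : ℂ) + 2) / 2) hc hx
    rw [hpow] at ih0 ih1 ⊢
    push_cast at ih0 ih1 ⊢
    rw [show c + ((N : ℂ) - 1) / 2 + 1 = c + ((N : ℂ) + 2 - 1) / 2 by ring,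
      show c + ((N : ℂ) - 1) / 2 + 3 / 2 = c + ((N : ℂ) + 2) / 2 by ring,
      show c + ((N : ℂ) - 1) / 2 + 1 / 2 = c + (N : ℂ) / 2 by ring] at hH
    rw [show -((N : ℂ) + 2) / 2 + 1 = -(N : ℂ) / 2 by ring,
      show -((N : ℂ) + 2) / 2 + 3 / 2 = (1 - (N : ℂ)) / 2 by ring,
      show -((N : ℂ) + 2) / 2 + 1 / 2 = (1 - ((N : ℂ) + 2)) / 2 by ring] at hG
    rw [show c + ((N : ℂ) + 1 - 1) / 2 = c + (N : ℂ) / 2 by ring,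
      show c + ((N : ℂ) + 1) / 2 = c + ((N : ℂ) + 2 - 1) / 2 by ring,
      show -((N : ℂ) + 1) / 2 = (1 - ((N : ℂ) + 2)) / 2 by ring,
      show (1 - ((N : ℂ) + 1)) / 2 = -(N : ℂ) / 2 by ring] at ih1
    refine mul_left_cancel₀ (hc2 N) ?_
    linear_combination (1 - x) ^ (c - 1 / 2) * (1 - x) ^ (N + 1) * hH + hG
      - (1 - x) * (N + 1) * ih0 + (2 * c + 2 * N + 1) * ih1

theorem ascPochhammer_neg_half_mul (N j : ℕ) :
    (ascPochhammer ℂ j).eval (-N / 2 : ℂ) * (ascPochhammer ℂ j).eval ((1 - N) / 2 : ℂ) * 4 ^ j =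
      (N.descFactorial (2 * j) : ℂ) := by
  have hs (n k : ℕ) : (n.descFactorial (k + 1) : ℂ) = (n - k) * n.descFactorial k := by
    rcases le_or_gt k n with h | h
    · rw [Nat.descFactorial_succ]
      push_cast [h]
      ring
    · simp [Nat.descFactorial_of_lt h]
  induction j with
  | zero => simp
  | succ j ih =>
    rw [show 2 * (j + 1) = 2 * j + 1 + 1 by ring, hs, hs, ← ih, ascPochhammer_succ_eval,
      ascPochhammer_succ_eval]
    push_cast
    ring

/-- The explicit polynomial on the right-hand side of
`ordinaryHypergeometric_euler_terminating`. -/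
theorem ordinaryHypergeometric_neg_half (c x : ℂ) {N B : ℕ} (hB : N < B) :
    ordinaryHypergeometric (-N / 2 : ℂ) ((1 - N) / 2) c x =
      ∑ j ∈ Finset.range B, (N.descFactorial (2 * j) : ℂ) /
        (4 ^ j * j.factorial * (ascPochhammer ℂ j).eval c) * x ^ j := by
  have h (j : ℕ) : hypTerm (-N / 2 : ℂ) ((1 - N) / 2) c x j = (N.descFactorial (2 * j) : ℂ) /
        (4 ^ j * j.factorial * (ascPochhammer ℂ j).eval c) * x ^ j := by
    rw [hypTerm, ← ascPochhammer_neg_half_mul]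
    field_simp
  rw [ordinaryHypergeometric_eq_tsum_hypTerm, tsum_eq_sum (s := Finset.range B)]
  · exact Finset.sum_congr rfl fun j _ ↦ h j
  · intro j hj
    rw [Finset.mem_range] at hj
    rw [h, Nat.descFactorial_of_lt (by omega)]
    simp

/-! ### Recurrence for Gegenbauer polynomials -/

/-- Contiguous relation behind the three-term recurrence of the Gegenbauer polynomials. -/
theorem ordinaryHypergeometric_opposite_step {a b c : ℂ} (y : ℂ) (hc : ∀ k : ℕ, (k : ℂ) ≠ -c)
    (habc : 2 * c = a + b + 1) (s0 : Summable (hypTerm a b c y))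
    (s1 : Summable (hypTerm (a - 1) (b + 1) c y)) (s2 : Summable (hypTerm (a + 1) (b - 1) c y)) :
    (b - a) * (1 - 2 * y) * ordinaryHypergeometric a b c y =
      b * ordinaryHypergeometric (a - 1) (b + 1) c y
        - a * ordinaryHypergeometric (a + 1) (b - 1) c y := by
  have key : ∀ k, (b - a) * hypTerm a b c y (k + 1) - (b - a) * 2 * y * hypTerm a b c y k
      - b * hypTerm (a - 1) (b + 1) c y (k + 1)
      + a * hypTerm (a + 1) (b - 1) c y (k + 1) = 0 := by
    intro k
    have hk : (k : ℂ) + 1 ≠ 0 := by exact_mod_cast k.succ_ne_zero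
    have hP := ascPochhammer_eval_ne_zero hc k
    have hck : c + k ≠ 0 := fun h ↦ hc k (by linear_combination h)
    have hf : (k.factorial : ℂ) ≠ 0 := by exact_mod_cast k.factorial_ne_zero
    -- `hR` avoids dividing by `a`, which may vanish
    have hL (z : ℂ) :
        (ascPochhammer ℂ (k + 1)).eval (z - 1) = (z - 1) * (ascPochhammer ℂ k).eval z := by
      rw [ascPochhammer_eval_succ_left, sub_add_cancel]
    have hR (z : ℂ) : z * (ascPochhammer ℂ (k + 1)).eval (z + 1) =
        (ascPochhammer ℂ k).eval z * (z + k) * (z + k + 1) := by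
      rw [← ascPochhammer_eval_succ_left, ascPochhammer_succ_eval, ascPochhammer_succ_eval]
      push_cast
      ring
    have e1 : b * hypTerm (a - 1) (b + 1) c y (k + 1) = (((k + 1).factorial : ℂ)⁻¹ *
        ((a - 1) * (ascPochhammer ℂ k).eval a) * ((ascPochhammer ℂ k).eval b * (b + k) *
        (b + k + 1)) * ((ascPochhammer ℂ (k + 1)).eval c)⁻¹) * y ^ (k + 1) := by
      rw [← hR, ← hL, hypTerm]
      ring
    have e2 : a * hypTerm (a + 1) (b - 1) c y (k + 1) = (((k + 1).factorial : ℂ)⁻¹ *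
        ((b - 1) * (ascPochhammer ℂ k).eval b) * ((ascPochhammer ℂ k).eval a * (a + k) *
        (a + k + 1)) * ((ascPochhammer ℂ (k + 1)).eval c)⁻¹) * y ^ (k + 1) := by
      rw [← hR, ← hL, hypTerm]
      ring
    rw [e1, e2]
    simp only [hypTerm, Nat.factorial_succ, ascPochhammer_succ_eval]
    obtain rfl : b = 2 * c - a - 1 := by linear_combination -habc
    push_cast
    field_simp
    ring
  have hsum : (b - a) * (∑' k, hypTerm a b c y (k + 1))
      - (b - a) * 2 * y * (∑' k, hypTerm a b c y k)
      - b * (∑' k, hypTerm (a - 1) (b + 1) c y (k + 1))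
      + a * (∑' k, hypTerm (a + 1) (b - 1) c y (k + 1)) = 0 := by
    have h0 := ((summable_nat_add_iff 1).2 s0).hasSum.mul_left (b - a)
    have h0' := s0.hasSum.mul_left ((b - a) * 2 * y)
    have h1 := ((summable_nat_add_iff 1).2 s1).hasSum.mul_left b
    have h2 := ((summable_nat_add_iff 1).2 s2).hasSum.mul_left a
    have := ((h0.sub h0').sub h1).add h2
    simp only [key] at this
    exact this.unique hasSum_zero
  have t0 := s0.tsum_eq_zero_add
  have t1 := s1.tsum_eq_zero_add
  have t2 := s2.tsum_eq_zero_add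
  rw [hypTerm_zero] at t0 t1 t2
  simp only [ordinaryHypergeometric_eq_tsum_hypTerm]
  linear_combination hsum + (b - a) * t0 - b * t1 + a * t2

theorem gegenbauerC_zero (ν : ℝ) (x : ℂ) : gegenbauerC 0 ν x = 1 := by
  rw [gegenbauerC, ordinaryHypergeometric_eq_tsum_hypTerm, tsum_eq_single 0, hypTerm_zero]
  · simp
  · intro k hk
    simpa using hypTerm_eq_zero 0 (Nat.pos_of_ne_zero hk) _ _ _

theorem ofReal_add_half_ne {ν : ℝ} (hν : 0 < ν) (k : ℕ) : (k : ℂ) ≠ -((ν : ℂ) + 1 / 2) := by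
  intro h
  have : (k : ℝ) = -(ν + 1 / 2) := by
    have := congrArg Complex.re h
    simpa using this
  have := k.cast_nonneg (α := ℝ)
  linarith

theorem gegenbauerC_one {ν : ℝ} (hν : 0 < ν) (x : ℂ) : gegenbauerC 1 ν x = 2 * ν * x := by
  have hc := ofReal_add_half_ne hν 0
  rw [gegenbauerC, ordinaryHypergeometric_eq_tsum_hypTerm,
    tsum_eq_sum (s := Finset.range 2)
      fun k hk ↦ hypTerm_eq_zero 1 (by rw [Finset.mem_range] at hk; omega) _ _ _]
  have hc' : (ν : ℂ) + 1 / 2 ≠ 0 := fun h ↦ hc (by rw [h]; simp)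
  have hc2 : 2 * (ν : ℂ) + 1 ≠ 0 := fun h ↦ hc' (by linear_combination h / 2)
  have e : (ν : ℂ) + 1 / 2 = (2 * ν + 1) / 2 := by ring
  simp only [hypTerm, Finset.sum_range_succ, Finset.sum_range_zero, e]
  norm_num
  left
  field_simp
  ring

/-- The three-term recurrence of the Gegenbauer polynomials. -/
theorem gegenbauerC_recurrence {ν : ℝ} (hν : 0 < ν) (n : ℕ) (x : ℂ) :
    2 * (n + 1 + ν) * x * gegenbauerC (n + 1) ν x =
      (n + 2) * gegenbauerC (n + 2) ν x + (n + 2 * ν) * gegenbauerC n ν x := by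
  have hc := ofReal_add_half_ne hν
  have s0 := summable_hypTerm_neg_nat (n + 1) (n + 1 + 2 * ν) ((ν : ℂ) + 1 / 2) ((1 - x) / 2)
  have s1 := summable_hypTerm_neg_nat (n + 2) (n + 2 + 2 * ν) ((ν : ℂ) + 1 / 2) ((1 - x) / 2)
  have s2 := summable_hypTerm_neg_nat n (n + 2 * ν) ((ν : ℂ) + 1 / 2) ((1 - x) / 2)
  push_cast at s0 s1
  have h := ordinaryHypergeometric_opposite_step (a := -((n : ℂ) + 1)) (b := n + 1 + 2 * ν)
    ((1 - x) / 2) hc (by ring) s0 (by convert s1 using 1; ring_nf) (by convert s2 using 1; ring_nf)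
  rw [show -((n : ℂ) + 1) - 1 = -(n + 2) by ring, show -((n : ℂ) + 1) + 1 = -n by ring,
    show (n : ℂ) + 1 + 2 * ν + 1 = n + 2 + 2 * ν by ring,
    show (n : ℂ) + 1 + 2 * ν - 1 = n + 2 * ν by ring] at h
  have hn1 : (n : ℂ) + 1 ≠ 0 := by exact_mod_cast n.succ_ne_zero
  have hn2 : (n : ℂ) + 2 ≠ 0 := by exact_mod_cast (n + 1).succ_ne_zero
  have e : (n : ℂ) + 1 + 1 = n + 2 := by ring
  have hf : (n.factorial : ℂ) ≠ 0 := by exact_mod_cast n.factorial_ne_zero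
  simp only [gegenbauerC, ascPochhammer_succ_eval, Nat.factorial_succ]
  push_cast
  rw [e]
  generalize ordinaryHypergeometric (-((n : ℂ) + 1)) (n + 1 + 2 * ν) ((ν : ℂ) + 1 / 2)
    ((1 - x) / 2) = F0 at *
  generalize ordinaryHypergeometric (-((n : ℂ) + 2)) (n + 2 + 2 * ν) ((ν : ℂ) + 1 / 2)
    ((1 - x) / 2) = F1 at *
  generalize ordinaryHypergeometric (-(n : ℂ)) (n + 2 * ν) ((ν : ℂ) + 1 / 2)
    ((1 - x) / 2) = F2 at *
  generalize (((ascPochhammer ℝ n).eval (2 * ν) : ℝ) : ℂ) = U at *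
  field_simp
  linear_combination (2 * ν + n) * U * h

/-! ### Gegenbauer expansion of powers -/

/-- The sum of `f n j` over all `n, j` with `n + 2 * j = q`. -/
def weightSum (q : ℕ) (f : ℕ → ℕ → ℂ) : ℂ :=
  ∑ n ∈ Finset.range (q + 1), ∑ j ∈ Finset.range (q + 1), if n + 2 * j = q then f n j else 0

theorem weightSum_eq {q A B : ℕ} (hA : q < A) (hB : q < B) (f : ℕ → ℕ → ℂ) :
    weightSum q f =
      ∑ n ∈ Finset.range A, ∑ j ∈ Finset.range B, if n + 2 * j = q then f n j else 0 := by
  have hin (n : ℕ) : ∑ j ∈ Finset.range (q + 1), (if n + 2 * j = q then f n j else 0) =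
      ∑ j ∈ Finset.range B, if n + 2 * j = q then f n j else 0 :=
    Finset.sum_subset (Finset.range_mono hB) fun j _ hj ↦
      if_neg (by rw [Finset.mem_range] at hj; omega)
  rw [weightSum, Finset.sum_congr rfl fun n _ ↦ hin n]
  exact Finset.sum_subset (Finset.range_mono hA) fun n _ hn ↦ Finset.sum_eq_zero fun j _ ↦
    if_neg (by rw [Finset.mem_range] at hn; omega)

theorem weightSum_congr (q : ℕ) {f g : ℕ → ℕ → ℂ} (h : ∀ n j, n + 2 * j = q → f n j = g n j) :
    weightSum q f = weightSum q g := by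
  refine Finset.sum_congr rfl fun n _ ↦ Finset.sum_congr rfl fun j _ ↦ ?_
  split_ifs with hq
  exacts [h n j hq, rfl]

theorem weightSum_add (q : ℕ) (f g : ℕ → ℕ → ℂ) :
    weightSum q (fun n j ↦ f n j + g n j) = weightSum q f + weightSum q g := by
  simp only [weightSum, ← Finset.sum_add_distrib]
  refine Finset.sum_congr rfl fun n _ ↦ Finset.sum_congr rfl fun j _ ↦ ?_
  split_ifs <;> simp

theorem mul_weightSum (q : ℕ) (a : ℂ) (f : ℕ → ℕ → ℂ) :
    a * weightSum q f = weightSum q fun n j ↦ a * f n j := by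
  simp [weightSum, Finset.mul_sum]

theorem weightSum_succ_left (q : ℕ) (f : ℕ → ℕ → ℂ) (h : ∀ j, f 0 j = 0) :
    weightSum (q + 1) f = weightSum q fun n j ↦ f (n + 1) j := by
  rw [weightSum_eq (A := q + 1 + 1) (B := q + 2) (by omega) (by omega), Finset.sum_range_succ',
    weightSum_eq (A := q + 1) (B := q + 2) (by omega) (by omega)]
  simp only [h, ite_self, Finset.sum_const_zero, add_zero]
  refine Finset.sum_congr rfl fun n _ ↦ Finset.sum_congr rfl fun j _ ↦
    if_congr (by omega) rfl rfl

theorem weightSum_succ_right (q : ℕ) (f g : ℕ → ℕ → ℂ) (hf : ∀ n, f n 0 = 0) (hg : ∀ j, g 0 j = 0)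
    (h : ∀ n j, f n (j + 1) = g (n + 1) j) : weightSum (q + 1) f = weightSum q g := by
  rw [weightSum_eq (A := q + 2) (B := q + 1 + 1) (by omega) (by omega),
    weightSum_eq (A := q + 2 + 1) (B := q + 1) (by omega) (by omega),
    Finset.sum_range_succ' _ (q + 2)]
  simp only [hg, ite_self, Finset.sum_const_zero, add_zero]
  refine Finset.sum_congr rfl fun n _ ↦ ?_
  rw [Finset.sum_range_succ']
  simp only [hf, ite_self, add_zero, h]
  refine Finset.sum_congr rfl fun j _ ↦ if_congr (by omega) rfl rfl

/-- The expansion of a monomial in Gegenbauer polynomials of order `l + 1`. -/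
theorem two_mul_pow_eq_weightSum_gegenbauerC (l q : ℕ) (x : ℂ) :
    (2 * x) ^ q = q.factorial * l.factorial * weightSum q fun n j ↦
      (n + l + 1) / ((n + l + 1 + j).factorial * j.factorial) * gegenbauerC n (l + 1) x := by
  have hl : (0 : ℝ) < l + 1 := by positivity
  have hf (n : ℕ) : (n.factorial : ℂ) ≠ 0 := by exact_mod_cast n.factorial_ne_zero
  induction q with
  | zero =>
    have : (l : ℂ) + 1 ≠ 0 := by exact_mod_cast l.succ_ne_zero
    have := hf l
    simp [weightSum, gegenbauerC_zero, Nat.factorial_succ]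
    field_simp
  | succ q ih =>
    let C (n : ℕ) : ℂ := gegenbauerC n (l + 1) x
    -- `n ↦ (n + 2ν - 1) C_{n-1}`, the lower neighbour in the three-term recurrence
    let D : ℕ → ℂ := fun n ↦ n.casesOn 0 fun n ↦ (n + 2 * (l + 1)) * C n
    have hrec (n : ℕ) : 2 * (n + l + 1) * x * C n = (n + 1) * C (n + 1) + D n := by
      cases n with
      | zero =>
        have h0 := gegenbauerC_zero (l + 1) x
        have h1 := gegenbauerC_one hl x
        push_cast at h1
        have hD : D 0 = 0 := rfl
        rw [hD]
        simp only [C, h0, h1, zero_add]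
        push_cast
        ring
      | succ n =>
        have h := gegenbauerC_recurrence hl n x
        simp only [C, D]
        push_cast at h ⊢
        linear_combination h
    -- The coefficient of `C_n` in degree `q + 1` splits by
    -- `(n + 2j)(n + ν) = n(n + ν + j) + j(n + 2ν)`, `ν = l + 1`; the two parts come from the upper
    -- and the lower neighbour in the recurrence.
    have hup : weightSum (q + 1) (fun n j ↦
        n * (n + l + 1 + j) / ((n + l + 1 + j).factorial * j.factorial) * C n) =
        weightSum q fun n j ↦
          1 / ((n + l + 1 + j).factorial * j.factorial) * ((n + 1) * C (n + 1)) := by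
      rw [weightSum_succ_left _ _ (by simp)]
      refine weightSum_congr q fun n j _ ↦ ?_
      have h1 := hf (n + l + 1 + j)
      have h2 := hf j
      have h3 : (n : ℂ) + l + 1 + j + 1 ≠ 0 := by exact_mod_cast (n + l + 1 + j).succ_ne_zero
      rw [show n + 1 + l + 1 + j = n + l + 1 + j + 1 by ring, Nat.factorial_succ]
      push_cast
      field_simp
      ring
    have hdown : weightSum (q + 1) (fun n j ↦
        j * (n + 2 * (l + 1)) / ((n + l + 1 + j).factorial * j.factorial) * C n) =
        weightSum q fun n j ↦ 1 / ((n + l + 1 + j).factorial * j.factorial) * D n := by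
      refine weightSum_succ_right q _ _ (by simp) (by simp [D]) fun n j ↦ ?_
      have h1 := hf (n + l + 1 + (j + 1))
      have h2 := hf j
      have h3 : (j : ℂ) + 1 ≠ 0 := by exact_mod_cast j.succ_ne_zero
      rw [show n + 1 + l + 1 + j = n + l + 1 + (j + 1) by ring, Nat.factorial_succ j]
      simp only [D]
      push_cast
      field_simp
    have hstep : (q + 1 : ℂ) * weightSum (q + 1) (fun n j ↦
        (n + l + 1) / ((n + l + 1 + j).factorial * j.factorial) * C n) =
        2 * x * weightSum q fun n j ↦
          (n + l + 1) / ((n + l + 1 + j).factorial * j.factorial) * C n := by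
      have h1 : (q + 1 : ℂ) * weightSum (q + 1) (fun n j ↦
          (n + l + 1) / ((n + l + 1 + j).factorial * j.factorial) * C n) =
          weightSum (q + 1) (fun n j ↦
            n * (n + l + 1 + j) / ((n + l + 1 + j).factorial * j.factorial) * C n +
            j * (n + 2 * (l + 1)) / ((n + l + 1 + j).factorial * j.factorial) * C n) := by
        rw [mul_weightSum]
        refine weightSum_congr _ fun n j h ↦ ?_
        have h' : (q : ℂ) + 1 = n + 2 * j := by exact_mod_cast h.symm
        rw [h']
        ring
      rw [h1, weightSum_add, hup, hdown, ← weightSum_add, mul_weightSum]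
      refine weightSum_congr _ fun n j _ ↦ ?_
      linear_combination -(1 / ((n + l + 1 + j).factorial * j.factorial) : ℂ) * hrec n
    rw [pow_succ, ih, Nat.factorial_succ]
    push_cast
    linear_combination -(q.factorial * l.factorial : ℂ) * hstep

/-- The Gegenbauer expansion of `(z - x) ^ p`; the coefficient of `C_n` is the polynomial that
Euler's transformation attaches to a Legendre function of the second kind. -/
theorem sub_pow_eq_sum_gegenbauerC (l p : ℕ) (x : ℂ) {z : ℂ} (hz : z ≠ 0) :
    (z - x) ^ p = p.factorial * l.factorial * ∑ n ∈ Finset.range (p + 1),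
      (-1) ^ n * (n + l + 1) * gegenbauerC n (l + 1) x /
        ((p - n).factorial * 2 ^ n * (n + l + 1).factorial) *
        (z ^ (p - n) * ordinaryHypergeometric (-(p - n : ℕ) / 2 : ℂ) ((1 - (p - n : ℕ)) / 2)
          (n + l + 2) (1 / z ^ 2)) := by
  have hf (n : ℕ) : (n.factorial : ℂ) ≠ 0 := by exact_mod_cast n.factorial_ne_zero
  -- the contribution of the `j`-th term in the expansion of `x ^ (n + 2 * j)`
  let g (n j : ℕ) : ℂ := p.factorial * l.factorial * (-1) ^ n *
    ((n + l + 1) / ((n + l + 1 + j).factorial * j.factorial) * gegenbauerC n (l + 1) x) *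
    (z ^ (p - (n + 2 * j)) / (2 ^ (n + 2 * j) * (p - (n + 2 * j)).factorial))
  have hleft : (z - x) ^ p = ∑ n ∈ Finset.range (p + 1), ∑ j ∈ Finset.range (p + 1),
      if n + 2 * j ≤ p then g n j else 0 := by
    have hq (q : ℕ) (hq : q ∈ Finset.range (p + 1)) :
        (-x) ^ q * z ^ (p - q) * (p.choose q : ℂ) = ∑ n ∈ Finset.range (p + 1),
          ∑ j ∈ Finset.range (p + 1), if n + 2 * j = q then g n j else 0 := by
      rw [Finset.mem_range] at hq
      rw [← weightSum_eq hq hq]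
      have h := two_mul_pow_eq_weightSum_gegenbauerC l q x
      have h2 : (-x) ^ q = (-1) ^ q * (1 / 2 ^ q) * (2 * x) ^ q := by
        rw [mul_pow, neg_pow]
        field_simp
      rw [h2, h, Nat.cast_choose ℂ (Nat.le_of_lt_succ hq), mul_weightSum, mul_weightSum,
        mul_comm _ (z ^ (p - q)), mul_weightSum, mul_comm _ (_ / _ : ℂ), mul_weightSum]
      refine weightSum_congr q fun n j hnj ↦ ?_
      subst hnj
      have := hf (n + 2 * j)
      have := hf (p - (n + 2 * j))
      have := hf (n + l + 1 + j)
      have := hf j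
      have h1 : (-1 : ℂ) ^ (n + 2 * j) = (-1) ^ n := by simp [pow_add, pow_mul]
      simp only [g, h1]
      field_simp
    rw [sub_eq_neg_add, add_pow, Finset.sum_congr rfl hq, Finset.sum_comm]
    refine Finset.sum_congr rfl fun n _ ↦ ?_
    rw [Finset.sum_comm]
    refine Finset.sum_congr rfl fun j _ ↦ ?_
    rw [Finset.sum_ite_eq]
    simp
  rw [hleft, Finset.mul_sum]
  refine Finset.sum_congr rfl fun n hn ↦ ?_
  rw [Finset.mem_range] at hn
  rw [ordinaryHypergeometric_neg_half _ _ (B := p + 1) (by omega), Finset.mul_sum, Finset.mul_sum,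
    Finset.mul_sum]
  refine Finset.sum_congr rfl fun j _ ↦ ?_
  split_ifs with hj
  · have hdf : ((p - n).descFactorial (2 * j) : ℂ) =
        (p - n).factorial / (p - (n + 2 * j)).factorial := by
      rw [eq_div_iff (hf _)]
      have := Nat.factorial_mul_descFactorial (n := p - n) (k := 2 * j) (by omega)
      rw [Nat.sub_sub] at this
      rw [mul_comm]
      exact_mod_cast this
    have hasc : ((n + l + 1 + j).factorial : ℂ) =
        (n + l + 1).factorial * (ascPochhammer ℂ j).eval ((n : ℂ) + l + 2) := by
      have := Nat.factorial_mul_ascFactorial (n + l + 1) j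
      rw [← this, ← ascPochhammer_nat_eq_ascFactorial]
      push_cast [ascPochhammer_eval_cast]
      ring_nf
    have hzp : z ^ (p - n) * (1 / z ^ 2) ^ j = z ^ (p - (n + 2 * j)) := by
      rw [show p - n = p - (n + 2 * j) + 2 * j by omega, pow_add, pow_mul, one_div, inv_pow,
        mul_assoc, mul_inv_cancel₀ (pow_ne_zero _ (pow_ne_zero _ hz)), mul_one]
    have hA : (ascPochhammer ℂ j).eval ((n : ℂ) + l + 2) ≠ 0 := fun h ↦ hf (n + l + 1 + j) (by
      rw [hasc, h, mul_zero])
    have := hf (p - n)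
    have := hf (p - (n + 2 * j))
    have := hf (n + l + 1)
    have := hf j
    have h4 : (2 : ℂ) ^ (2 * j) = 4 ^ j := by rw [pow_mul]; norm_num
    simp only [g, ← hzp, hdf, hasc, pow_add, h4]
    field_simp
  · rw [Nat.descFactorial_of_lt (by omega)]
    simp

/-! ### Legendre functions of the second kind and the binomial kernel -/

/-- For `ν = n + l + 1/2` and `μ = p + l + 3/2` with `n ≤ p`, the function `(ζ² - 1)^(μ/2) Q_ν^μ(ζ)`
is, up to a constant, a polynomial in `ζ`. -/
theorem rpow_mul_legendreQ {n p : ℕ} (hn : n ≤ p) (l : ℕ) {z w : ℝ} (hz : 1 < z) (hw : 0 < w)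
    (hwz : w ^ 2 = z ^ 2 - 1) :
    ((w ^ ((p : ℝ) + l + 3 / 2) : ℝ) : ℂ) * legendreQ (n + l + 1 / 2) (p + l + 3 / 2) z =
      ((Real.sqrt Real.pi : ℝ) : ℂ) * Complex.exp (Complex.I * (Real.pi : ℂ) * (p + l + 3 / 2)) *
        (n + p + 2 * l + 2).factorial /
          ((((2 : ℝ) ^ ((l : ℝ) + 3 / 2) : ℝ) : ℂ) * 2 ^ n * (n + l + 1).factorial) *
        (z ^ (p - n) * ordinaryHypergeometric (-(p - n : ℕ) / 2 : ℂ) ((1 - (p - n : ℕ)) / 2)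
          (n + l + 2) (1 / (z : ℂ) ^ 2)) := by
  have hz0 : 0 < z := one_pos.trans hz
  have hzC : (z : ℂ) ≠ 0 := by exact_mod_cast hz0.ne'
  have hwC : (w : ℂ) ≠ 0 := by exact_mod_cast hw.ne'
  have hpn : ((p - n : ℕ) : ℂ) = p - n := by push_cast [hn]; ring
  have hG1 : Complex.Gamma ((n : ℂ) + l + 1 / 2 + (p + l + 3 / 2) + 1) =
      (n + p + 2 * l + 2).factorial := by
    rw [← Complex.Gamma_nat_eq_factorial]
    push_cast
    ring_nf
  have hG2 : Complex.Gamma ((n : ℂ) + l + 1 / 2 + 3 / 2) = (n + l + 1).factorial := by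
    rw [← Complex.Gamma_nat_eq_factorial]
    push_cast
    ring_nf
  have hpow : ((z : ℂ) + 1) ^ (((p : ℂ) + l + 3 / 2) / 2) *
      ((z : ℂ) - 1) ^ (((p : ℂ) + l + 3 / 2) / 2) = ((w ^ ((p : ℝ) + l + 3 / 2) : ℝ) : ℂ) := by
    have h1 : ((p : ℂ) + l + 3 / 2) / 2 = ((((p : ℝ) + l + 3 / 2) / 2 : ℝ) : ℂ) := by
      push_cast
      ring
    have h2 : (z : ℂ) + 1 = ((z + 1 : ℝ) : ℂ) := by push_cast; ring
    have h3 : (z : ℂ) - 1 = ((z - 1 : ℝ) : ℂ) := by push_cast; ring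
    rw [h1, h2, h3, ← Complex.ofReal_cpow (by linarith), ← Complex.ofReal_cpow (by linarith),
      ← Complex.ofReal_mul, ← Real.mul_rpow (by linarith) (by linarith),
      show (z + 1) * (z - 1) = w ^ 2 by rw [hwz]; ring, ← Real.rpow_natCast, ← Real.rpow_mul hw.le]
    congr 2
    push_cast
    ring
  have h2pow : (2 : ℂ) ^ ((n : ℂ) + l + 1 / 2 + 1) = ((2 : ℝ) ^ ((l : ℝ) + 3 / 2) : ℝ) * 2 ^ n := by
    rw [Complex.ofReal_cpow (by norm_num), ← Complex.cpow_natCast]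
    push_cast
    rw [← Complex.cpow_add _ _ (by norm_num)]
    ring_nf
  have hzpow : (z : ℂ) ^ ((n : ℂ) + l + 1 / 2 + (p + l + 3 / 2) + 1) = z ^ (n + p + 2 * l + 3) := by
    rw [← Complex.cpow_natCast]
    push_cast
    ring_nf
  have hww : ((w ^ ((p : ℝ) + l + 3 / 2) : ℝ) : ℂ) * ((w ^ ((p : ℝ) + l + 3 / 2) : ℝ) : ℂ) =
      w ^ (2 * p + 2 * l + 3) := by
    rw [← Complex.ofReal_mul, ← Real.rpow_add hw, ← Complex.ofReal_pow, ← Real.rpow_natCast]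
    push_cast
    ring_nf
  have hsum_ne (k : ℕ) : (k : ℂ) ≠ -((n : ℂ) + l + 2) := fun h ↦ by
    have : ((k + n + l + 2 : ℕ) : ℂ) = 0 := by push_cast; linear_combination h
    exact absurd (Nat.cast_eq_zero.1 this) (by omega)
  have hsum_ne' (k : ℕ) : 2 * ((n : ℂ) + l + 2) + k ≠ 0 := fun h ↦ by
    have : ((2 * (n + l + 2) + k : ℕ) : ℂ) = 0 := by push_cast; linear_combination h
    exact absurd (Nat.cast_eq_zero.1 this) (by omega)
  have hnorm : ‖(1 / (z : ℂ) ^ 2)‖ < 1 := by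
    rw [norm_div, norm_one, norm_pow, Complex.norm_real, Real.norm_of_nonneg hz0.le,
      div_lt_one (by positivity)]
    exact one_lt_pow₀ hz two_ne_zero
  have heuler := ordinaryHypergeometric_euler_terminating hsum_ne hsum_ne' hnorm (p - n)
  -- the exponent `c + N - 1/2` is `μ = p + l + 3/2`
  have hone : (1 - 1 / (z : ℂ) ^ 2) ^ ((n : ℂ) + l + 2 + (p - n : ℕ) - 1 / 2) =
      w ^ (2 * p + 2 * l + 3) / z ^ (2 * p + 2 * l + 3) := by
    have h1 : (1 - 1 / (z : ℂ) ^ 2) = (((w / z) ^ 2 : ℝ) : ℂ) := by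
      rw [div_pow, hwz]
      push_cast
      field_simp
    have h2 : (n : ℂ) + l + 2 + (p - n : ℕ) - 1 / 2 = (((p : ℝ) + l + 3 / 2 : ℝ) : ℂ) := by
      rw [hpn]
      push_cast
      ring
    rw [h1, h2, ← Complex.ofReal_cpow (by positivity), ← Real.rpow_natCast,
      ← Real.rpow_mul (by positivity),
      show ((2 : ℕ) : ℝ) * ((p : ℝ) + l + 3 / 2) = (2 * p + 2 * l + 3 : ℕ) by push_cast; ring,
      Real.rpow_natCast, div_pow]
    push_cast
    rfl
  have harg1 : ((n : ℂ) + l + 1 / 2 + (p + l + 3 / 2) + 1) / 2 =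
      n + l + 2 + (((p - n : ℕ) : ℂ) - 1) / 2 := by
    rw [hpn]
    ring
  have harg2 : ((n : ℂ) + l + 1 / 2 + (p + l + 3 / 2) + 2) / 2 =
      n + l + 2 + ((p - n : ℕ) : ℂ) / 2 := by
    rw [hpn]
    ring
  have harg3 : (n : ℂ) + l + 1 / 2 + 3 / 2 = n + l + 2 := by ring
  rw [hone] at heuler
  rw [legendreQ, hG1, hG2, hpow, h2pow, hzpow, harg1, harg2, harg3, ← heuler]
  have hz3 : (z : ℂ) ^ (2 * p + 2 * l + 3) = z ^ (n + p + 2 * l + 3) * z ^ (p - n) := by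
    rw [← pow_add]
    congr 1
    omega
  have hf : ((n + l + 1).factorial : ℂ) ≠ 0 := by exact_mod_cast (n + l + 1).factorial_ne_zero
  have ht : (((2 : ℝ) ^ ((l : ℝ) + 3 / 2) : ℝ) : ℂ) ≠ 0 := by
    exact_mod_cast (Real.rpow_pos_of_pos two_pos _).ne'
  rw [hz3, ← hww]
  field_simp

/-- The phases of the prefactor and of the Legendre functions cancel. -/
theorem I_mul_zpow_mul_exp (p l : ℕ) :
    Complex.I * (-1 : ℂ) ^ ((p : ℤ) - ((l + 2 : ℕ) : ℤ)) *
      Complex.exp (Complex.I * (Real.pi : ℂ) * (p + l + 3 / 2)) = 1 := by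
  have h : Complex.exp (Complex.I * (Real.pi : ℂ) * (p + l + 3 / 2)) =
      (-1) ^ (p + l + 1) * Complex.I := by
    rw [show Complex.I * (Real.pi : ℂ) * (p + l + 3 / 2) =
        ((p + l + 1 : ℕ) : ℂ) * (Real.pi * Complex.I) + Real.pi / 2 * Complex.I by push_cast; ring,
      Complex.exp_add, Complex.exp_nat_mul, Complex.exp_pi_mul_I, Complex.exp_pi_div_two_mul_I]
  have h1 : (-1 : ℂ) ^ p * (-1) ^ p = 1 := by rw [← mul_pow]; simp
  have h2 : (-1 : ℂ) ^ l * (-1) ^ l = 1 := by rw [← mul_pow]; simp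
  have h3 : (-1 : ℂ) ^ l ≠ 0 := by simp
  rw [h, zpow_sub₀ (by norm_num), zpow_natCast, zpow_natCast]
  simp only [pow_add]
  field_simp
  linear_combination -Complex.I ^ 2 * h1 - Complex.I_sq

/-- Law of cosines: the kernel is a power of `ζ - cos γ`. -/
theorem norm_sub_sq_eq_zetaParam {d : ℕ} {x x' : EuclideanSpace ℝ (Fin d)} {t : ℝ}
    (hx : 0 < ‖x‖) (hx' : 0 < ‖x'‖) (ht : t = inner ℝ x x' / (‖x‖ * ‖x'‖)) :
    ‖x - x'‖ ^ 2 = 2 * ‖x‖ * ‖x'‖ * (zetaParam ‖x‖ ‖x'‖ - t) := by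
  rw [norm_sub_sq_real, ht, zetaParam]
  field_simp
  ring

theorem mainTheorem11 (d k p : ℕ) (hd : Even d) (hd4 : 4 ≤ d)
    (hp : (p : ℝ) = (k : ℝ) - (d : ℝ) / 2)
    (x x' : EuclideanSpace ℝ (Fin d)) (r r' γ : ℝ)
    (hr : r = ‖x‖) (hr' : r' = ‖x'‖) (hr_pos : 0 < r) (hr'_pos : 0 < r') (hrr' : r ≠ r')
    (hγ : γ ∈ Set.Icc 0 Real.pi) (hcosγ : Real.cos γ = inner ℝ x x' / (r * r')) :
    ((binomialKernel d k x x' : ℝ) : ℂ) =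
      Complex.I * (-1 : ℂ) ^ ((p : ℤ) - ((d / 2 : ℕ) : ℤ)) *
        (((2 : ℝ) ^ (((d : ℝ) - 1) / 2) / Real.sqrt Real.pi : ℝ) : ℂ) *
        (p.factorial : ℂ) * ((d / 2 - 2).factorial : ℂ) *
        (((2 * r * r') ^ p : ℝ) : ℂ) *
        (((((max r r') ^ 2 - (min r r') ^ 2) / (2 * r * r')) ^
            ((p : ℝ) + ((d : ℝ) - 1) / 2) : ℝ) : ℂ) *
        ∑ n ∈ Finset.range (p + 1),
          ((-1 : ℂ) ^ n * ((n : ℂ) + (d : ℂ) / 2 - 1) *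
              gegenbauerC n ((d : ℝ) / 2 - 1) ((Real.cos γ : ℝ) : ℂ)) /
            (((p - n).factorial : ℂ) * ((n + p + d - 2).factorial : ℂ)) *
            legendreQ ((n : ℂ) + ((d : ℂ) - 3) / 2) ((p : ℂ) + ((d : ℂ) - 1) / 2)
              ((zetaParam r r' : ℝ) : ℂ) := by
  obtain ⟨l, rfl⟩ : ∃ l, d = 2 * (l + 2) := by
    obtain ⟨m, rfl⟩ := hd
    exact ⟨m - 2, by omega⟩
  have hk : k = p + (l + 2) := by
    have : (k : ℝ) = p + (l + 2) := by push_cast at hp; linarith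
    exact_mod_cast this
  set z := zetaParam r r' with hz
  -- `w` is the positive square root of `ζ² - 1`
  set w := ((max r r') ^ 2 - (min r r') ^ 2) / (2 * r * r') with hw
  have hw0 : 0 < w := by
    have hlt : min r r' < max r r' := min_lt_max.2 hrr'
    have hmin : 0 < min r r' := lt_min hr_pos hr'_pos
    have : min r r' ^ 2 < max r r' ^ 2 := pow_lt_pow_left₀ hlt hmin.le two_ne_zero
    exact div_pos (sub_pos.2 this) (by positivity)
  have hwz : w ^ 2 = z ^ 2 - 1 := by
    have h : (max r r' ^ 2 - min r r' ^ 2) ^ 2 = (r ^ 2 - r' ^ 2) ^ 2 := by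
      rcases le_total r r' with h | h
      · rw [max_eq_right h, min_eq_left h]
        ring
      · rw [max_eq_left h, min_eq_right h]
    rw [hw, hz, zetaParam, div_pow, h]
    field_simp
    ring
  have hz0 : 0 < z := by rw [hz, zetaParam]; positivity
  have hz1 : 1 < z := by nlinarith [sq_pos_of_pos hw0]
  have hkernel : binomialKernel (2 * (l + 2)) k x x' =
      (2 * r * r') ^ p * (z - Real.cos γ) ^ p := by
    subst hr hr'
    rw [binomialKernel, hk,
      show 2 * ((p + (l + 2) : ℕ) : ℤ) - ((2 * (l + 2) : ℕ) : ℤ) = ((2 * p : ℕ) : ℤ) by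
        push_cast; ring,
      zpow_natCast, pow_mul, norm_sub_sq_eq_zetaParam hr_pos hr'_pos hcosγ, mul_pow]
  have hzC : (z : ℂ) ≠ 0 := by exact_mod_cast hz0.ne'
  have hexp := sub_pow_eq_sum_gegenbauerC l p ((Real.cos γ : ℝ) : ℂ) hzC
  have hdhalf : 2 * (l + 2) / 2 = l + 2 := by omega
  have he1 : ((2 * (l + 2) : ℕ) : ℝ) / 2 - 1 = l + 1 := by push_cast; ring
  have he2 : (((2 * (l + 2) : ℕ) : ℝ) - 1) / 2 = l + 3 / 2 := by push_cast; ring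
  have he3 (n : ℕ) : (n : ℂ) + ((2 * (l + 2) : ℕ) : ℂ) / 2 - 1 = n + l + 1 := by push_cast; ring
  have he4 (n : ℕ) : (n : ℂ) + (((2 * (l + 2) : ℕ) : ℂ) - 3) / 2 = n + l + 1 / 2 := by
    push_cast; ring
  have he5 : (p : ℂ) + (((2 * (l + 2) : ℕ) : ℂ) - 1) / 2 = p + l + 3 / 2 := by push_cast; ring
  have he6 (n : ℕ) : n + p + 2 * (l + 2) - 2 = n + p + 2 * l + 2 := by omega
  have hphase := I_mul_zpow_mul_exp p l
  simp only [hdhalf, he1, he2, he3, he4, he5, he6, Nat.add_sub_cancel, ← add_assoc]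
  rw [hkernel]
  push_cast
  push_cast at hexp
  rw [hexp]
  simp only [Finset.mul_sum]
  refine Finset.sum_congr rfl fun n hn ↦ ?_
  have hQ := rpow_mul_legendreQ (Nat.lt_succ_iff.1 (Finset.mem_range.1 hn)) l hz1 hw0 hwz
  generalize legendreQ ((n : ℂ) + l + 1 / 2) (p + l + 3 / 2) z = Q at hQ ⊢
  generalize ((w ^ ((p : ℝ) + l + 3 / 2) : ℝ) : ℂ) = W at hQ ⊢
  push_cast at hphase
  generalize Complex.I * (-1 : ℂ) ^ ((p : ℤ) - ((l : ℤ) + 2)) = S at hphase ⊢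
  generalize Complex.exp (Complex.I * (Real.pi : ℂ) * (p + l + 3 / 2)) = E at hphase hQ
  generalize (z : ℂ) ^ (p - n) * ordinaryHypergeometric (-(p - n : ℕ) / 2 : ℂ)
    ((1 - (p - n : ℕ)) / 2) (n + l + 2) (1 / (z : ℂ) ^ 2) = F at hQ ⊢
  generalize (-1 : ℂ) ^ n * (n + l + 1) * gegenbauerC n (l + 1) (Complex.cos γ) = G
  have hT : (((2 : ℝ) ^ ((l : ℝ) + 3 / 2) : ℝ) : ℂ) ≠ 0 := by
    exact_mod_cast (Real.rpow_pos_of_pos two_pos _).ne'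
  have hpi : ((Real.sqrt Real.pi : ℝ) : ℂ) ≠ 0 := by
    exact_mod_cast (Real.sqrt_pos.2 Real.pi_pos).ne'
  generalize (((2 : ℝ) ^ ((l : ℝ) + 3 / 2) : ℝ) : ℂ) = T at hT hQ ⊢
  generalize ((Real.sqrt Real.pi : ℝ) : ℂ) = c at hpi hQ ⊢
  have hf : ((n + p + 2 * l + 2).factorial : ℂ) ≠ 0 := by exact_mod_cast Nat.factorial_ne_zero _
  generalize ((n + p + 2 * l + 2).factorial : ℂ) = M at hf hQ ⊢
  have hcancel (a b : ℂ) : G / (a * b) * F = T / c * (G / (a * M)) * (c * M / (T * b) * F) := by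
    field_simp
  calc _ = S * E * ((2 * (r : ℂ) * r') ^ p * (p.factorial * l.factorial *
          (G / ((p - n).factorial * 2 ^ n * (n + l + 1).factorial) * F))) := by
        rw [hphase, one_mul]
    _ = S * (T / c) * p.factorial * l.factorial * (2 * (r : ℂ) * r') ^ p *
          (G / ((p - n).factorial * M)) *
          (c * E * M / (T * 2 ^ n * (n + l + 1).factorial) * F) := by
        rw [mul_assoc ((p - n).factorial : ℂ), hcancel, mul_assoc T]
        ring
    _ = _ := by
        rw [← hQ]
        ring
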